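/- Let $\mathbb K$ be a field of characteristic zero, $\theta\in\mathbb K$, and let $(A,R)$ be an arbitrary Rota--Baxter algebra of weight $\theta$ over $\mathbb K$: $A$ is an associative $\mathbb K$-algebra (not necessarily commutative) and $R:A\to A$ is a linear map with $$R(x)R(y)=R\bigl(R(x)y+xR(y)+\theta xy\bigr)\qquad(x,y\in A).$$ For $a,b\in A$ put $a\triangleright_\theta b:=R(a)b-bR(a)-\theta ba$, and for $X\in A$ define $\mathfrak l_\theta^{(1)}(X):=X$, $\mathfrak l_\theta^{(n+1)}(X):=\mathfrak l_\theta^{(n)}(X)\triangleright_\theta X$ and $\mathfrak L_\theta^{(n)}(X):=R\bigl(\mathfrak l_\theta^{(n)}(X)\bigr)$ for $n\ge 1$. For $\sigma\in S_n$ let $d(\sigma)=|\{i<n:\sigma_i>\sigma_{i+1}\}|$ be its number of descents. Extend $R$ coefficientwise to power series in $t$. Then, for every $X\in A$, the Atkinson recursion $$F=1+R(F\cdot Xt)$$ is solved in $A[[t]]$ by $$F(t)=\exp\Biggl(\sum_{m>0}\ \sum_{\substack{i_1+\cdots+i_n=m\\ i_1,\dots,i_n>0}}\ \int_0^t dt_1\int_0^{t_1}dt_2\cdots\int_0^{t_{n-1}}dt_n\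 \sum_{\sigma\in S_n}\frac{(-1)^{d(\sigma)}}{n\binom{n-1}{d(\sigma)}}\;t_{\sigma_n}^{\,i_1-1}t_{\sigma_{n-1}}^{\,i_2-1}\cdots t_{\sigma_1}^{\,i_n-1}\ \mathfrak L_\theta^{(i_1)}(X)\cdots\mathfrak L_\theta^{(i_n)}(X)\Biggr),$$ where the inner sum runs over all compositions $(i_1,\dots,i_n)$ of $m$ of any length $n\geq 1$, and the integrals and the exponential are formal. This holds when $A$ is unital; if $A$ has no unit, it holds with the series taken in $\tilde A[[t]]$, where $\tilde A=\mathbb K\oplus A$ is the unitization, and $R$ is applied to $F\cdot Xt$, whose coefficients lie in the ideal $A$. -/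

import Mathlib

open scoped Nat

noncomputable section

/-! ### Rota–Baxter operators and iterated pre-Lie words -/

section RotaBaxter

variable {K A : Type*} [Field K] [NonUnitalRing A] [Module K A]

/-- `R` is a Rota–Baxter operator of weight `θ` on the (not necessarily unital, not necessarily
commutative) associative `K`-algebra `A`. -/
def IsRotaBaxter (θ : K) (R : A →ₗ[K] A) : Prop :=
  ∀ x y : A, R x * R y = R (R x * y + x * R y + θ • (x * y))

/-- The left pre-Lie product `a ▷ b = R(a) b - b R(a) - θ b a`. -/
def rbPreLie (θ : K) (R : A →ₗ[K] A) (a b : A) : A :=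
  R a * b - b * R a - θ • (b * a)

/-- The left pre-Lie words `𝔩⁽ⁿ⁾(a)`: `𝔩⁽¹⁾(a) = a` and `𝔩⁽ⁿ⁺¹⁾(a) = 𝔩⁽ⁿ⁾(a) ▷ a`.
The index `0` is not used; the value there is set to `0`. -/
def rbLittleWord (θ : K) (R : A →ₗ[K] A) (a : A) : ℕ → A
  | 0 => 0
  | 1 => a
  | n + 2 => rbPreLie θ R (rbLittleWord θ R a (n + 1)) a

/-- `𝔏⁽ⁿ⁾(a) = R(𝔩⁽ⁿ⁾(a))`, for `n ≥ 1`. -/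
def rbWord (θ : K) (R : A →ₗ[K] A) (a : A) (n : ℕ) : A :=
  R (rbLittleWord θ R a n)

end RotaBaxter

/-! ### Iterated integrals and the descent coefficients -/

section Integrals

variable {K : Type*} [Field K]

/-- `∫₀ᵗ p(s) ds` for a polynomial `p`, that is `∑ aₖ sᵏ ↦ ∑ aₖ tᵏ⁺¹ / (k + 1)`. -/
def formalIntegral (p : Polynomial K) : Polynomial K :=
  p.sum fun k a => Polynomial.monomial (k + 1) (a / ((k : K) + 1))

variable (K) in
/-- The iterated integral
`∫₀ᵗ dt₁ ∫₀^{t₁} dt₂ ⋯ ∫₀^{tₙ₋₁} dtₙ  t₁ ^ e₁ t₂ ^ e₂ ⋯ tₙ ^ eₙ`, as a polynomial in `t`: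
it is `∫₀ᵗ t₁ ^ e₁ J(t₁) dt₁`, where `J(t₁) = ∫₀^{t₁} dt₂ ⋯ ∫₀^{tₙ₋₁} dtₙ  t₂ ^ e₂ ⋯ tₙ ^ eₙ`.
The variable `tₖ` of the text corresponds to the index `k - 1 : Fin n`. -/
def iteratedIntegral : (n : ℕ) → (Fin n → ℕ) → Polynomial K
  | 0, _ => 1
  | n + 1, e => formalIntegral (Polynomial.X ^ e 0 * iteratedIntegral n (Fin.tail e))

/-- The number `d(σ) = |{i < n : σ(i) > σ(i+1)}|` of descents of a permutation. -/
def descentNumber {n : ℕ} (σ : Equiv.Perm (Fin n)) : ℕ :=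
  (Finset.univ.filter fun i : Fin n => ∃ h : i.val + 1 < n, σ ⟨i.val + 1, h⟩ < σ i).card

variable (K) in
/-- The polynomial in `t`
`∫₀ᵗ dt₁ ∫₀^{t₁} dt₂ ⋯ ∫₀^{tₙ₋₁} dtₙ
  ∑_σ (-1) ^ d(σ) / (n * binom (n - 1) d(σ)) * t_{σ(n)} ^ (i₁ - 1) ⋯ t_{σ(1)} ^ (iₙ - 1)`
(the finite sum over `σ` is written in front of the integral). In the monomial of `σ`, the variable
`t_{σ(j)}` has exponent `i_{n+1-j} - 1`, so `tₖ` has exponent `i_{n+1-σ⁻¹(k)} - 1`. -/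
def strichartzIntegral (n : ℕ) (i : Fin n → ℕ) : Polynomial K :=
  ∑ σ : Equiv.Perm (Fin n),
    Polynomial.C ((-1 : K) ^ descentNumber σ / ((n : K) * ((n - 1).choose (descentNumber σ) : K))) *
      iteratedIntegral K n (fun k => i (Fin.rev (σ.symm k)) - 1)

end Integrals

/-! ### Series with coefficients in a unital algebra -/

section Series

variable (K : Type*) {B : Type*} [Field K] [Ring B] [Algebra K B]

/-- The part of index `m` of the exponent: the sum over all compositions `i₁ + ⋯ + iₙ = m` of `m`
into positive parts of `strichartzIntegral (i₁, …, iₙ)(t) • L⁽ⁱ¹⁾ ⋯ L⁽ⁱⁿ⁾`. -/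
def strichartzTerm (L : ℕ → B) (m : ℕ) : PowerSeries B :=
  ∑ c : Composition m,
    PowerSeries.mk fun N =>
      (strichartzIntegral K c.length c.blocksFun).coeff N •
        (List.ofFn fun j => L (c.blocksFun j)).prod

/-- The exponent `∑_{m > 0} strichartzTerm m`. The term of index `m` is a multiple of `t ^ m`, so
that only the indices `1 ≤ m ≤ N` contribute to the coefficient of `t ^ N`. -/
def strichartzSeries (L : ℕ → B) : PowerSeries B :=
  PowerSeries.mk fun N => ∑ m ∈ Finset.Icc 1 N, PowerSeries.coeff N (strichartzTerm K L m)

/-- The exponential `∑ₖ Ω ^ k / k!` of a series `Ω` with zero constant term. As `Ω ^ k` is a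
multiple of `t ^ k`, only `k ≤ N` contribute to the coefficient of `t ^ N`. -/
def seriesExp (Ω : PowerSeries B) : PowerSeries B :=
  PowerSeries.mk fun N =>
    ∑ k ∈ Finset.range (N + 1), ((k ! : K)⁻¹) • PowerSeries.coeff N (Ω ^ k)

variable {K}

/-- The coefficientwise extension of a linear operator to power series in `t`. -/
def coeffwise (T : B →ₗ[K] B) (f : PowerSeries B) : PowerSeries B :=
  PowerSeries.mk fun N => T (PowerSeries.coeff N f)

/-- `F` solves the Atkinson recursion `F = 1 + T(F · x t)` in `B[[t]]`. -/
def SolvesAtkinson (T : B →ₗ[K] B) (x : B) (F : PowerSeries B) : Prop :=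
  F = 1 + coeffwise T (F * (PowerSeries.C x * PowerSeries.X))

end Series

/-- The operator `R` of an algebra `A` without unit, on the unitization `K ⊕ A`: the given `R` on
the ideal `A`, and zero on `K`. (In `1 + R(F · X t)` it is only applied to elements of `A`.) -/
def unitizationOp {K A : Type*} [Field K] [NonUnitalRing A] [Module K A]
    [IsScalarTower K A A] [SMulCommClass K A A] (R : A →ₗ[K] A) :
    Unitization K A →ₗ[K] Unitization K A :=
  Unitization.inrHom K K A ∘ₗ R ∘ₗ Unitization.sndHom K K A

end

/-!
Let `Y` be the solution of `Y' = Y · ∑ⱼ 𝔏⁽ʲ⁾ tʲ⁻¹`, `Y(0) = 1`. The theorem splits into two facts.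

*`Y` solves the Atkinson recursion.* Let `F` be the solution of the recursion. By the Rota–Baxter
identity, `G = F · ∑ⱼ 𝔏⁽ʲ⁾ tʲ⁻¹` satisfies the fixed point equation `G = R(F X + t G X)`, which
determines `G`. So does `F'`, hence `F' = F · ∑ⱼ 𝔏⁽ʲ⁾ tʲ⁻¹` and `F = Y`. In terms of coefficients
this is an induction, see `solvesAtkinson_of_forall_coeff`. Only the identity on an ideal containing
`X` is used, so that the unitization is covered as well.

*`Y` is the exponential of the Strichartz series.* Expanded in words in the `𝔏⁽ʲ⁾`, the coefficient
of `Y` at `(i₁, …, iₙ)` is the product of the reciprocals of the partial sums `i₁ + ⋯ + iₖ`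
(`prefixWeight`). The coefficients of `(Y - 1) ^ k` are then sums, over the ways to cut the word
into `k` blocks, of products of such weights. For a fixed set of cuts, this product is
`∏ᵥ 1 / hook(v)` for the forest whose trees are the blocks, each of them a chain. The hook formula
for forests (`sum_tailWeight_linearExtensions`), which plays the part of the shuffle formula for
iterated integrals, rewrites it as a sum of iterated integrals over the permutations that are
monotone on each block. A permutation with `d` descents is monotone on the blocks of exactly those
sets of cuts that contain its `d` descents, so in the generating function in the number of blocks
its coefficient is `s ^ (d + 1) (1 + s) ^ (n - 1 - d)` (`wordGen_ofFn`). Replacing `s ^ k` by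
`(-1) ^ (k + 1) / k`, that is, taking the logarithm, turns this into a Beta integral with value
`(-1) ^ d / (n binom(n - 1, d))` (`logFunctional_eq_choose`). Hence the Strichartz series is
`log Y` (`coeff_strichartzSeries`), and `exp (log Y) = Y` follows from the identity of power series
in one commuting variable (`PowerSeries.seriesExp_of_coeff_eq_log`).
-/

open scoped Nat

/-! ### Exponential and logarithm of power series -/

namespace PowerSeries

variable {B : Type*} [Ring B]

theorem coeff_pow_of_lt {u : PowerSeries B} (hu : constantCoeff u = 0) {N k : ℕ} (h : N < k) :
    coeff N (u ^ k) = 0 :=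
  coeff_of_lt_order N (lt_of_lt_of_le (by exact_mod_cast h)
    (le_order_pow_of_constantCoeff_eq_zero k hu))

theorem coeff_pow_congr {f g : PowerSeries B} {N : ℕ} (h : ∀ i ≤ N, coeff i f = coeff i g) (k : ℕ) :
    ∀ i ≤ N, coeff i (f ^ k) = coeff i (g ^ k) := by
  induction k with
  | zero => simp
  | succ k ih =>
    intro i hi
    rw [pow_succ, pow_succ, coeff_mul, coeff_mul]
    refine Finset.sum_congr rfl fun p hp => ?_
    have := Finset.HasAntidiagonal.mem_antidiagonal.1 hp
    rw [ih _ (by omega), h _ (by omega)]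

variable {K : Type*} [Field K] [Algebra K B]

theorem coeff_smul_of_algebra (c : K) (f : PowerSeries B) (N : ℕ) :
    coeff N (c • f) = c • coeff N f :=
  rfl

theorem coeff_aeval_of_constantCoeff_eq_zero {u : PowerSeries B} (hu : constantCoeff u = 0)
    (p : Polynomial K) {N M : ℕ} (hN : N ≤ M) :
    coeff N (Polynomial.aeval u p) = ∑ k ∈ Finset.range (M + 1), p.coeff k • coeff N (u ^ k) := by
  rw [Polynomial.aeval_eq_sum_range' (n := max (M + 1) (p.natDegree + 1)) (by omega), map_sum]
  simp only [coeff_smul_of_algebra]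
  symm
  refine Finset.sum_subset (by simp) fun k _ hk => ?_
  rw [coeff_pow_of_lt hu (by simp at hk; omega), smul_zero]

variable [CharZero K]

theorem one_add_X_mul_derivative_log : (1 + X) * derivative K (log K) = 1 := by
  rw [deriv_log]
  ext n
  rcases n with _ | n
  · simp
  · rw [add_mul, one_mul, map_add, coeff_succ_X_mul]
    simp [coeff_one, pow_succ]

theorem exp_subst_log : (exp K).subst (log K) = 1 + (X : PowerSeries K) := by
  set G := (exp K).subst (log K)
  have h0 : coeff 0 G = 1 := by
    rw [coeff_subst' HasSubst.log, finsum_eq_single _ 0]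
    · simp
    · intro n hn
      simp [hn]
  have hD : (1 + X) * derivative K G = G := by
    rw [derivative_subst HasSubst.log, derivative_exp]
    linear_combination G * one_add_X_mul_derivative_log (K := K)
  have hrec (n : ℕ) : coeff (n + 2) G * (n + 2) = - n * coeff (n + 1) G := by
    have := congrArg (coeff (n + 1)) hD
    rw [add_mul, one_mul, map_add, coeff_succ_X_mul, coeff_derivative, coeff_derivative] at this
    push_cast at this
    linear_combination this
  have h1 : coeff 1 G = 1 := by
    have := congrArg (coeff 0) hD
    rw [add_mul, one_mul, map_add, coeff_zero_X_mul, coeff_derivative] at this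
    simpa [h0] using this
  have h2 (n : ℕ) : coeff (n + 2) G = 0 := by
    induction n with
    | zero => simpa using hrec 0
    | succ n ih =>
      have := hrec (n + 1)
      rw [ih, mul_zero] at this
      refine (mul_eq_zero.1 this).resolve_right ?_
      exact_mod_cast (by omega : n + 1 + 2 ≠ 0)
  ext n
  rcases n with _ | _ | n
  · simp [h0]
  · simp [h1, coeff_one]
  · simp [h2, coeff_one, coeff_X]

/-- Modulo `X ^ (N + 1)`, the identity `exp (log (1 + X)) = 1 + X` only involves polynomials. -/
theorem coeff_sum_pow_trunc_log {N i : ℕ} (hi : i ≤ N) :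
    (∑ k ∈ Finset.range (N + 1), Polynomial.C ((k ! : K)⁻¹) * trunc (N + 1) (log K) ^ k).coeff i =
      coeff i (1 + X : PowerSeries K) := by
  rw [← exp_subst_log, coeff_subst' HasSubst.log,
    finsum_eq_sum_of_support_subset (s := Finset.range (N + 1)), Polynomial.finsetSum_coeff]
  · refine Finset.sum_congr rfl fun k _ => ?_
    rw [Polynomial.coeff_C_mul, ← Polynomial.coeff_coe, Polynomial.coe_pow,
      coeff_pow_congr (g := log K) (N := N) _ k i hi]
    · simp [coeff_exp]
    · intro j hj
      rw [Polynomial.coeff_coe, coeff_trunc, if_pos (by omega)]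
  · intro k hk
    by_contra hlt
    simp only [Finset.coe_range, Set.mem_Iio] at hlt
    exact hk (by simp only [coeff_pow_of_lt (constantCoeff_log (A := K)) (show i < k by omega),
      smul_zero])

/-- If `Ω = log (1 + u)`, in the sense of the power series of the logarithm, then
`exp Ω = 1 + u`. -/
theorem seriesExp_of_coeff_eq_log {u Ω : PowerSeries B} (hu : constantCoeff u = 0)
    (hΩ : ∀ N, coeff N Ω = ∑ k ∈ Finset.range (N + 1), coeff k (log K) • coeff N (u ^ k)) :
    seriesExp K Ω = 1 + u := by
  ext N
  have hΩN : ∀ i ≤ N, coeff i Ω = coeff i (Polynomial.aeval u (trunc (N + 1) (log K))) := by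
    intro i hi
    rw [coeff_aeval_of_constantCoeff_eq_zero hu _ le_rfl, hΩ]
    refine Finset.sum_congr rfl fun k hk => ?_
    rw [coeff_trunc, if_pos (by simp at hk; omega)]
  calc coeff N (seriesExp K Ω)
      = coeff N (Polynomial.aeval u (∑ k ∈ Finset.range (N + 1),
          Polynomial.C ((k ! : K)⁻¹) * trunc (N + 1) (log K) ^ k)) := by
        rw [seriesExp, coeff_mk, map_sum, map_sum]
        refine Finset.sum_congr rfl fun k _ => ?_
        rw [← Polynomial.smul_eq_C_mul, map_smul, coeff_smul_of_algebra,
          map_pow (Polynomial.aeval u),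
          coeff_pow_congr hΩN k N le_rfl]
    _ = coeff N (Polynomial.aeval u (1 + Polynomial.X : Polynomial K)) := by
        rw [coeff_aeval_of_constantCoeff_eq_zero hu _ le_rfl,
          coeff_aeval_of_constantCoeff_eq_zero hu _ le_rfl]
        refine Finset.sum_congr rfl fun k hk => ?_
        rw [coeff_sum_pow_trunc_log (by simp at hk; omega), ← Polynomial.coeff_coe]
        simp
    _ = coeff N (1 + u) := by simp

end PowerSeries

/-! ### The hook formula for forests -/

section HookFormula

variable {K : Type*} [Field K]

variable (K) in
/-- The product of the reciprocals of the tail sums, `∏ₖ 1 / (zₖ + zₖ₊₁ + ⋯ + zₙ)`. It is the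
coefficient of the iterated integral of the monomial `t₁ ^ (z₁ - 1) ⋯ tₙ ^ (zₙ - 1)`. -/
def tailWeight : (n : ℕ) → (Fin n → ℕ) → K
  | 0, _ => 1
  | n + 1, z => (((∑ k, z k : ℕ) : K))⁻¹ * tailWeight n (Fin.tail z)

variable {V : Type*} [Fintype V] [DecidableEq V]

/-- The enumerations `q₀, q₁, …` of a finite set `S` in which `u` never precedes `v` if `u` lies
above `v`, that is, `r v u`; these are the linear extensions of `r` on `S`. -/
def linearExtensions (r : V → V → Prop) [DecidableRel r] (S : Finset V) (n : ℕ) :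
    Finset (Fin n → V) :=
  {q | Finset.univ.image q = S ∧ ∀ i j, r (q i) (q j) → i ≤ j}

/-- The hook of `v`: the total weight of the elements above `v`. -/
def hook (r : V → V → Prop) [DecidableRel r] (y : V → ℕ) (v : V) : ℕ :=
  ∑ u with r v u, y u

variable {r : V → V → Prop} [DecidableRel r]

theorem mem_linearExtensions {S : Finset V} {n : ℕ} {q : Fin n → V} :
    q ∈ linearExtensions r S n ↔
      Finset.univ.image q = S ∧ ∀ i j, r (q i) (q j) → i ≤ j := by
  simp [linearExtensions]

/-- A linear extension starts with a minimal element and goes on with a linear extension of the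
rest. -/
theorem cons_mem_linearExtensions (hrefl : ∀ v, r v v) {S : Finset V} {n : ℕ} {a : V}
    {q : Fin n → V} :
    (Fin.cons a q : Fin (n + 1) → V) ∈ linearExtensions r S (n + 1) ↔
      a ∈ S ∧ (∀ u ∈ S, r u a → u = a) ∧ q ∈ linearExtensions r (S.erase a) n := by
  simp only [mem_linearExtensions]
  constructor
  · rintro ⟨rfl, h⟩
    have hne (i) : ¬ r (q i) a := fun hr => by simpa using h i.succ 0 (by simpa using hr)
    have hqa (i) : q i ≠ a := fun e => hne i (e ▸ hrefl _)
    refine ⟨Finset.mem_image.2 ⟨0, by simp⟩, ?_, ?_, fun i j hij => ?_⟩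
    · intro u hu hr
      obtain ⟨i, -, rfl⟩ := Finset.mem_image.1 hu
      induction i using Fin.cases with
      | zero => rfl
      | succ i => exact absurd (by simpa using hr) (hne i)
    · ext v
      simp only [Finset.mem_image, Finset.mem_univ, true_and, Finset.mem_erase, Fin.exists_fin_succ,
        Fin.cons_zero, Fin.cons_succ]
      constructor
      · rintro ⟨i, rfl⟩
        exact ⟨hqa i, Or.inr ⟨i, rfl⟩⟩
      · rintro ⟨h1, h2 | h2⟩
        · exact absurd h2.symm h1
        · exact h2
    · simpa using h i.succ j.succ (by simpa using hij)
  · rintro ⟨ha, hmin, hS, h⟩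
    have hqS (i) : q i ∈ S.erase a := hS ▸ Finset.mem_image_of_mem q (Finset.mem_univ i)
    refine ⟨?_, fun i j hij => ?_⟩
    · rw [← Finset.insert_erase ha, ← hS]
      ext v
      simp [Fin.exists_fin_succ, eq_comm]
    · induction i using Fin.cases with
      | zero => exact Fin.zero_le _
      | succ i =>
        induction j using Fin.cases with
        | zero =>
          have := hqS i
          rw [Finset.mem_erase] at this
          exact absurd (hmin _ this.2 (by simpa using hij)) this.1
        | succ j => simpa using h i j (by simpa using hij)

theorem injective_of_mem_linearExtensions (hrefl : ∀ v, r v v) {S : Finset V} {n : ℕ}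
    {q : Fin n → V} (hq : q ∈ linearExtensions r S n) : Function.Injective q := by
  intro i j hij
  have h := (mem_linearExtensions.1 hq).2
  exact le_antisymm (h i j (hij ▸ hrefl _)) (h j i (hij ▸ hrefl _))

/-- In a forest, each element of `S` lies above exactly one minimal element of `S`. -/
theorem sum_hook_minimal (hrefl : ∀ v, r v v) (htrans : ∀ u v w, r u v → r v w → r u w)
    (hanti : ∀ u v, r u v → r v u → u = v)
    (hforest : ∀ u v w, r u w → r v w → r u v ∨ r v u) (y : V → ℕ)
    {S : Finset V} (hS : ∀ v ∈ S, ∀ u, r v u → u ∈ S) :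
    ∑ a ∈ S with ∀ u ∈ S, r u a → u = a, hook r y a = ∑ u ∈ S, y u := by
  let : PartialOrder V :=
    { le := r, le_refl := hrefl, le_trans := htrans, le_antisymm := hanti }
  set M := S.filter fun a => ∀ u ∈ S, r u a → u = a with hM
  have huniq (u : V) (hu : u ∈ S) : (M.filter fun a => r a u).card = 1 := by
    obtain ⟨a, hau, ha⟩ := exists_minimal_le_of_wellFoundedLT (· ∈ S) u hu
    refine Finset.card_eq_one.2 ⟨a, Finset.eq_singleton_iff_unique_mem.2 ⟨?_, fun b hb => ?_⟩⟩
    · simp only [hM, Finset.mem_filter]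
      exact ⟨⟨ha.1, fun v hv hva => hanti _ _ hva (ha.2 hv hva)⟩, hau⟩
    · simp only [hM, Finset.mem_filter] at hb
      rcases hforest a b u hau hb.2 with h | h
      · exact (hb.1.2 a ha.1 h).symm
      · exact hanti _ _ h (ha.2 hb.1.1 h)
  simp only [hook]
  rw [Finset.sum_comm' (t' := S) (s' := fun u => M.filter fun a => r a u)]
  · refine Finset.sum_congr rfl fun u hu => ?_
    rw [Finset.sum_const, huniq u hu, one_smul]
  · intro a u
    simp only [hM, Finset.mem_filter, Finset.mem_univ, true_and]
    exact ⟨fun h => ⟨h, hS a h.1.1 u h.2⟩, fun h => h.1⟩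

/-- The hook formula for forests, with weights: the sum over the linear extensions of the
reciprocals of their tail sums is the product of the reciprocals of the hooks. The first element of
a linear extension is a root `a`, and the sum of the hooks of the roots is the total weight. -/
theorem sum_tailWeight_linearExtensions [CharZero K] (hrefl : ∀ v, r v v)
    (htrans : ∀ u v w, r u v → r v w → r u w) (hanti : ∀ u v, r u v → r v u → u = v)
    (hforest : ∀ u v w, r u w → r v w → r u v ∨ r v u) {y : V → ℕ} (hy : ∀ v, 0 < y v) (n : ℕ)
    {S : Finset V} (hcard : S.card = n) (hS : ∀ v ∈ S, ∀ u, r v u → u ∈ S) :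
    ∑ q ∈ linearExtensions r S n, tailWeight K n (fun k => y (q k)) =
      ∏ v ∈ S, ((hook r y v : ℕ) : K)⁻¹ := by
  induction n generalizing S with
  | zero =>
    obtain rfl := Finset.card_eq_zero.1 hcard
    have : linearExtensions r (∅ : Finset V) 0 = Finset.univ := by
      ext q
      simp only [mem_linearExtensions, Finset.mem_univ, iff_true]
      exact ⟨rfl, fun i => i.elim0⟩
    simp [this, tailWeight]
  | succ n ih =>
    have hpos : ((∑ u ∈ S, y u : ℕ) : K) ≠ 0 := by
      rw [Nat.cast_ne_zero]
      obtain ⟨v, hv⟩ : S.Nonempty := Finset.card_pos.1 (by omega)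
      exact (Finset.sum_pos (fun v _ => hy v) ⟨v, hv⟩).ne'
    have hhook (v : V) : ((hook r y v : ℕ) : K) ≠ 0 := by
      rw [Nat.cast_ne_zero]
      exact (Finset.sum_pos (fun v _ => hy v) ⟨v, by simp [hrefl]⟩).ne'
    have hstep : ∑ q ∈ linearExtensions r S (n + 1), tailWeight K (n + 1) (fun k => y (q k)) =
        ∑ a ∈ S with ∀ u ∈ S, r u a → u = a, ∑ q ∈ linearExtensions r (S.erase a) n,
          ((∑ u ∈ S, y u : ℕ) : K)⁻¹ * tailWeight K n (fun k => y (q k)) := by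
      rw [Finset.sum_sigma']
      symm
      refine Finset.sum_bij (fun p _ => (Fin.cons p.1 p.2 : Fin (n + 1) → V)) ?_ ?_ ?_ ?_
      · rintro ⟨a, q⟩ h
        simp only [Finset.mem_sigma, Finset.mem_filter] at h
        exact (cons_mem_linearExtensions hrefl).2 ⟨h.1.1, h.1.2, h.2⟩
      · rintro ⟨a, q⟩ - ⟨b, p⟩ - h
        obtain ⟨rfl, rfl⟩ := Fin.cons_injective2 h
        rfl
      · intro q hq
        rw [← Fin.cons_self_tail q] at hq
        obtain ⟨h1, h2, h3⟩ := (cons_mem_linearExtensions hrefl).1 hq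
        exact ⟨⟨q 0, Fin.tail q⟩, by simp [h1, h3]; exact h2, Fin.cons_self_tail q⟩
      · rintro ⟨a, q⟩ h
        simp only [Finset.mem_sigma, Finset.mem_filter] at h
        have hmem := (cons_mem_linearExtensions hrefl).2 ⟨h.1.1, h.1.2, h.2⟩
        rw [tailWeight]
        congr 3
        rw [← (mem_linearExtensions.1 hmem).1, Finset.sum_image]
        exact (injective_of_mem_linearExtensions hrefl hmem).injOn
    calc _ = ∑ a ∈ S with ∀ u ∈ S, r u a → u = a,
          ((∑ u ∈ S, y u : ℕ) : K)⁻¹ * ((hook r y a : K) * ∏ v ∈ S, ((hook r y v : ℕ) : K)⁻¹) := by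
          rw [hstep]
          refine Finset.sum_congr rfl fun a ha => ?_
          rw [Finset.mem_filter] at ha
          rw [← Finset.mul_sum, ih (by rw [Finset.card_erase_of_mem ha.1, hcard]; rfl) ?_,
            ← Finset.mul_prod_erase S _ ha.1, mul_inv_cancel_left₀ (hhook a)]
          intro v hv u hvu
          rw [Finset.mem_erase] at hv ⊢
          exact ⟨fun e => hv.1 (ha.2 v hv.2 (e ▸ hvu)), hS v hv.2 u hvu⟩
      _ = _ := by
          rw [← Finset.mul_sum, ← Finset.sum_mul, ← Nat.cast_sum,
            sum_hook_minimal hrefl htrans hanti hforest y hS, inv_mul_cancel_left₀ hpos]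

end HookFormula

/-! ### Series indexed by words -/

section Words

variable {K : Type*} [Field K]

/-- The words with positive letters and sum `N`, that is, the compositions of `N`, as a finite set
of lists. -/
def positiveWords (N : ℕ) : Finset (List ℕ) :=
  (Finset.univ : Finset (Composition N)).image Composition.blocks

theorem mem_positiveWords {N : ℕ} {x : List ℕ} :
    x ∈ positiveWords N ↔ (∀ a ∈ x, 0 < a) ∧ x.sum = N := by
  simp only [positiveWords, Finset.mem_image, Finset.mem_univ, true_and]
  constructor
  · rintro ⟨c, rfl⟩
    exact ⟨fun a ha => c.blocks_pos ha, c.blocks_sum⟩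
  · rintro ⟨h1, h2⟩
    exact ⟨⟨x, fun {a} ha => h1 a ha, h2⟩, rfl⟩

theorem sum_positiveWords {M : Type*} [AddCommMonoid M] (N : ℕ) (f : List ℕ → M) :
    ∑ x ∈ positiveWords N, f x = ∑ c : Composition N, f c.blocks :=
  Finset.sum_image fun _ _ _ _ h => Composition.ext h

/-- The convolution of two functions on words, dual to deconcatenation. -/
def wordConv (f g : List ℕ → K) (x : List ℕ) : K :=
  ∑ i ∈ Finset.range (x.length + 1), f (x.take i) * g (x.drop i)

variable (K) in
/-- The unit for the convolution of functions on words. -/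
def wordOne (x : List ℕ) : K := if x = [] then 1 else 0

variable {B : Type*} [Ring B] [Algebra K B]

/-- The series `∑ₓ f(x) L(x) t ^ |x|` over the words `x = (i₁, …, iₙ)` with positive letters, where
`L(x) = L⁽ⁱ¹⁾ ⋯ L⁽ⁱⁿ⁾` and `|x| = i₁ + ⋯ + iₙ`. -/
def wordSeries (L : ℕ → B) (f : List ℕ → K) : PowerSeries B :=
  PowerSeries.mk fun N => ∑ x ∈ positiveWords N, f x • (x.map L).prod

theorem coeff_wordSeries (L : ℕ → B) (f : List ℕ → K) (N : ℕ) :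
    PowerSeries.coeff N (wordSeries L f) = ∑ x ∈ positiveWords N, f x • (x.map L).prod := by
  rw [wordSeries, PowerSeries.coeff_mk]

theorem positiveWords_zero : positiveWords 0 = {[]} := by
  ext x
  rw [mem_positiveWords, Finset.mem_singleton]
  constructor
  · rintro ⟨h1, h2⟩
    rcases x with _ | ⟨a, l⟩
    · rfl
    · have := h1 a (by simp)
      simp at h2
      omega
  · rintro rfl
    simp

theorem coeff_zero_wordSeries (L : ℕ → B) (f : List ℕ → K) :
    PowerSeries.coeff 0 (wordSeries L f) = f [] • 1 := by
  simp [coeff_wordSeries, positiveWords_zero]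

theorem wordSeries_wordOne (L : ℕ → B) : wordSeries L (wordOne K) = 1 := by
  ext N
  rcases N with _ | N
  · simp [coeff_zero_wordSeries, wordOne]
  · rw [coeff_wordSeries, PowerSeries.coeff_one, if_neg (by omega)]
    refine Finset.sum_eq_zero fun x hx => ?_
    have : x ≠ [] := by
      rintro rfl
      simpa using (mem_positiveWords.1 hx).2
    rw [wordOne, if_neg this, zero_smul]

theorem wordSeries_mul (L : ℕ → B) (f g : List ℕ → K) :
    wordSeries L f * wordSeries L g = wordSeries L (wordConv f g) := by
  ext N
  simp only [PowerSeries.coeff_mul, coeff_wordSeries, Finset.sum_mul_sum, wordConv, Finset.sum_smul]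
  simp only [← Finset.sum_product', Finset.sum_sigma']
  refine Finset.sum_bij' (fun p _ => ⟨p.2.1 ++ p.2.2, p.2.1.length⟩)
    (fun z _ => ⟨((z.1.take z.2).sum, (z.1.drop z.2).sum), z.1.take z.2, z.1.drop z.2⟩)
    ?_ ?_ ?_ ?_ ?_
  · rintro ⟨⟨i, j⟩, x, y⟩ h
    simp only [Finset.mem_sigma, Finset.HasAntidiagonal.mem_antidiagonal, Finset.mem_product,
      mem_positiveWords] at h
    obtain ⟨hij, ⟨hx, rfl⟩, hy, rfl⟩ := h
    simp only [Finset.mem_sigma, mem_positiveWords, List.mem_append, List.sum_append,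
      Finset.mem_range, List.length_append]
    exact ⟨⟨fun a ha => ha.elim (hx a) (hy a), hij⟩, by omega⟩
  · rintro ⟨z, i⟩ h
    simp only [Finset.mem_sigma, mem_positiveWords] at h
    obtain ⟨⟨hz, rfl⟩, -⟩ := h
    simp only [Finset.mem_sigma, Finset.HasAntidiagonal.mem_antidiagonal, Finset.mem_product,
      mem_positiveWords]
    exact ⟨List.sum_take_add_sum_drop z i, ⟨fun a ha => hz a (List.mem_of_mem_take ha), trivial⟩,
      fun a ha => hz a (List.mem_of_mem_drop ha), trivial⟩
  · rintro ⟨⟨i, j⟩, x, y⟩ h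
    simp only [Finset.mem_sigma, Finset.HasAntidiagonal.mem_antidiagonal, Finset.mem_product,
      mem_positiveWords] at h
    obtain ⟨hij, ⟨hx, rfl⟩, hy, rfl⟩ := h
    simp
  · rintro ⟨z, i⟩ h
    simp only [Finset.mem_sigma, Finset.mem_range] at h
    have : i ≤ z.length := by omega
    simp [this]
  · rintro ⟨⟨i, j⟩, x, y⟩ -
    simp only [List.take_left, List.drop_left, List.map_append, List.prod_append]
    rw [smul_mul_smul_comm]

/-! ### The solution of `Y' = Y L` -/

variable (K) in
/-- The product of the reciprocals of the partial sums `acc + a₁ + ⋯ + aₖ` of a word, where `acc` is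
an initial value. For `acc = 0` these are the coefficients of the series of iterated integrals that
solves `Y' = Y L`. -/
def prefixWeight : ℕ → List ℕ → K
  | _, [] => 1
  | acc, a :: l => ((acc + a : ℕ) : K)⁻¹ * prefixWeight (acc + a) l

theorem prefixWeight_append_singleton (acc : ℕ) (l : List ℕ) (a : ℕ) :
    prefixWeight K acc (l ++ [a]) = prefixWeight K acc l * ((acc + l.sum + a : ℕ) : K)⁻¹ := by
  induction l generalizing acc with
  | nil => simp [prefixWeight]
  | cons b l ih =>
    rw [List.cons_append, prefixWeight, ih, prefixWeight, List.sum_cons, mul_assoc]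
    congr 4
    ring

/-- The differential equation `t Y' = Y · ∑ L⁽ʲ⁾ tʲ`, coefficientwise. -/
theorem coeff_wordSeries_prefixWeight [CharZero K] (L : ℕ → B) (N : ℕ) :
    ((N + 1 : ℕ) : K) • PowerSeries.coeff (N + 1) (wordSeries L (prefixWeight K 0)) =
      ∑ j ∈ Finset.range (N + 1),
        PowerSeries.coeff (N - j) (wordSeries L (prefixWeight K 0)) * L (j + 1) := by
  simp only [coeff_wordSeries, Finset.smul_sum, Finset.sum_mul]
  rw [Finset.sum_sigma']
  symm
  refine Finset.sum_bij (fun p _ => p.2 ++ [p.1 + 1]) ?_ ?_ ?_ ?_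
  · rintro ⟨j, x⟩ h
    simp only [Finset.mem_sigma, Finset.mem_range, mem_positiveWords] at h
    obtain ⟨hj, hx, hs⟩ := h
    simp only [mem_positiveWords, List.mem_append, List.mem_singleton, List.sum_append,
      List.sum_singleton]
    refine ⟨?_, by omega⟩
    rintro a (ha | rfl)
    · exact hx a ha
    · omega
  · rintro ⟨j, x⟩ - ⟨k, y⟩ - h
    obtain ⟨rfl, h⟩ := List.append_inj' h rfl
    simpa using h
  · intro z hz
    obtain ⟨hpos, hs⟩ := mem_positiveWords.1 hz
    have hne : z ≠ [] := by
      rintro rfl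
      simp at hs
    obtain ⟨x, a, rfl⟩ := List.eq_nil_or_concat' z |>.resolve_left hne
    have ha : 0 < a := hpos a (by simp)
    simp only [List.sum_append, List.sum_singleton] at hs
    refine ⟨⟨a - 1, x⟩, ?_, ?_⟩
    · simp only [Finset.mem_sigma, Finset.mem_range, mem_positiveWords]
      exact ⟨by omega, fun b hb => hpos b (by simp [hb]), by omega⟩
    · simp only [Nat.sub_add_cancel ha]
  · rintro ⟨j, x⟩ h
    simp only [Finset.mem_sigma, Finset.mem_range, mem_positiveWords] at h
    obtain ⟨hj, hx, hs⟩ := h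
    have : 0 + x.sum + (j + 1) = N + 1 := by omega
    rw [prefixWeight_append_singleton, this, smul_smul, mul_comm, mul_assoc,
      inv_mul_cancel₀, mul_one]
    · simp
    · exact_mod_cast N.succ_ne_zero

/-! ### Convolution powers and cuts of a word -/

variable (K) in
/-- The convolution powers of `prefixWeight K 0 - 1`. -/
def wordPow : ℕ → List ℕ → K
  | 0 => wordOne K
  | k + 1 => wordConv (fun x => prefixWeight K 0 x - wordOne K x) (wordPow k)

theorem pow_wordSeries_sub_one (L : ℕ → B) (k : ℕ) :
    (wordSeries L (prefixWeight K 0) - 1) ^ k = wordSeries L (wordPow K k) := by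
  have h : wordSeries L (prefixWeight K 0) - 1 =
      wordSeries L (fun x => prefixWeight K 0 x - wordOne K x) := by
    ext N
    rw [map_sub, ← wordSeries_wordOne (K := K) L]
    simp only [coeff_wordSeries, sub_smul, Finset.sum_sub_distrib]
  induction k with
  | zero => exact (wordSeries_wordOne L).symm
  | succ k ih => rw [pow_succ', ih, h, wordSeries_mul, wordPow]

variable (K) in
/-- The generating function of the convolution powers at a word. -/
def wordGen (x : List ℕ) : PowerSeries K :=
  PowerSeries.mk fun k => wordPow K k x

theorem wordGen_nil : wordGen K [] = 1 := by
  ext k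
  rcases k with _ | k
  · simp [wordGen, wordPow, wordOne]
  · simp [wordGen, wordPow, wordConv, wordOne, prefixWeight, PowerSeries.coeff_one]

/-- The recursion `∑ₖ sᵏ uᵏ = 1 + s u ∑ₖ sᵏ uᵏ`: a word is split after its first block. -/
theorem wordGen_cons (a : ℕ) (l : List ℕ) :
    wordGen K (a :: l) = PowerSeries.X * ∑ i ∈ Finset.range (l.length + 1),
      PowerSeries.C (prefixWeight K 0 (a :: l.take i)) * wordGen K (l.drop i) := by
  ext k
  rcases k with _ | k
  · simp [wordGen, wordPow, wordOne]
  · rw [PowerSeries.coeff_succ_X_mul, wordGen, PowerSeries.coeff_mk, wordPow, wordConv,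
      List.length_cons, Finset.sum_range_succ', map_sum]
    simp [wordOne, prefixWeight, wordGen, mul_assoc]

variable (K) in
/-- The generating function, in the number of cuts, of the ways to cut the word into blocks, a
block being weighted by `prefixWeight`; the first block continues a block of sum `acc`. -/
noncomputable def cutGen : ℕ → List ℕ → PowerSeries K
  | _, [] => 0
  | acc, [a] => PowerSeries.C ((acc + a : ℕ) : K)⁻¹
  | acc, a :: b :: l => PowerSeries.C ((acc + a : ℕ) : K)⁻¹ *
      (cutGen (acc + a) (b :: l) + PowerSeries.X * cutGen 0 (b :: l))

/-- The first block ends at some letter, and the rest is cut arbitrarily. -/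
theorem cutGen_cons (acc a : ℕ) (l : List ℕ) :
    cutGen K acc (a :: l) = ∑ i ∈ Finset.range (l.length + 1),
      PowerSeries.C (prefixWeight K acc (a :: l.take i)) * wordGen K (l.drop i) := by
  induction l generalizing acc a with
  | nil => simp [cutGen, prefixWeight, wordGen_nil]
  | cons b l ih =>
    rw [cutGen, List.length_cons, Finset.sum_range_succ', ih, ih 0 b, ← wordGen_cons, mul_add,
      Finset.mul_sum]
    simp [prefixWeight, mul_assoc]

theorem wordGen_eq_X_mul_cutGen {x : List ℕ} (hx : x ≠ []) :
    wordGen K x = PowerSeries.X * cutGen K 0 x := by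
  obtain ⟨a, l, rfl⟩ := List.exists_cons_of_ne_nil hx
  rw [wordGen_cons, cutGen_cons]

end Words

/-! ### Cuts and chains -/

section Cuts

/-- `SameBlock C v u`: the positions `u ≤ v` lie in the same block, where the word is cut after the
position `i` exactly when `C i` holds. As a forest order with `v` below `u`, it makes each block a
chain with root its last letter, and the hook of `v` is a partial sum of its block. -/
def SameBlock {m : ℕ} (C : Fin m → Bool) (v u : Fin (m + 1)) : Prop :=
  u ≤ v ∧ ∀ i : Fin m, u ≤ i.castSucc → i.castSucc < v → C i = false

instance {m : ℕ} (C : Fin m → Bool) : DecidableRel (SameBlock C) := fun v u =>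
  inferInstanceAs (Decidable (u ≤ v ∧ ∀ i : Fin m, u ≤ i.castSucc → i.castSucc < v → C i = false))

variable {m : ℕ}

theorem SameBlock.refl (C : Fin m → Bool) (v : Fin (m + 1)) : SameBlock C v v :=
  ⟨le_rfl, fun _ h1 h2 => absurd h2 h1.not_gt⟩

theorem SameBlock.trans {C : Fin m → Bool} {u v w : Fin (m + 1)} (huv : SameBlock C u v)
    (hvw : SameBlock C v w) : SameBlock C u w := by
  refine ⟨hvw.1.trans huv.1, fun i h1 h2 => ?_⟩
  rcases lt_or_ge i.castSucc v with h | h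
  · exact hvw.2 i h1 h
  · exact huv.2 i h h2

theorem SameBlock.antisymm {C : Fin m → Bool} {u v : Fin (m + 1)} (huv : SameBlock C u v)
    (hvu : SameBlock C v u) : u = v :=
  le_antisymm hvu.1 huv.1

theorem SameBlock.total {C : Fin m → Bool} {u v w : Fin (m + 1)} (hu : SameBlock C u w)
    (hv : SameBlock C v w) : SameBlock C u v ∨ SameBlock C v u := by
  rcases le_total u v with h | h
  · exact Or.inr ⟨h, fun i h1 h2 => hv.2 i (hu.1.trans h1) h2⟩
  · exact Or.inl ⟨h, fun i h1 h2 => hu.2 i (hv.1.trans h1) h2⟩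

theorem sameBlock_zero {C : Fin m → Bool} {u : Fin (m + 1)} : SameBlock C 0 u ↔ u = 0 := by
  constructor
  · exact fun h => Fin.le_zero_iff.1 h.1
  · rintro rfl
    exact SameBlock.refl C 0

theorem sameBlock_cons_succ_succ {c : Bool} {C : Fin m → Bool} {u v : Fin (m + 1)} :
    SameBlock (Fin.cons c C) v.succ u.succ ↔ SameBlock C v u := by
  simp only [SameBlock, Fin.succ_le_succ_iff, Fin.forall_fin_succ (n := m), Fin.cons_zero,
    Fin.cons_succ, Fin.castSucc_zero, Fin.castSucc_succ, Fin.succ_lt_succ_iff]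
  simp

theorem sameBlock_cons_succ_zero {c : Bool} {C : Fin m → Bool} {v : Fin (m + 1)} :
    SameBlock (Fin.cons c C) v.succ 0 ↔ c = false ∧ SameBlock C v 0 := by
  simp only [SameBlock, Fin.forall_fin_succ (n := m), Fin.cons_zero,
    Fin.cons_succ, Fin.castSucc_zero, Fin.castSucc_succ, Fin.succ_lt_succ_iff]
  simp

/-- A permutation respects the order of all pairs in a common block once it does so for
neighbours. -/
theorem forall_sameBlock_iff {C : Fin m → Bool} {τ : Equiv.Perm (Fin (m + 1))} :
    (∀ v u, SameBlock C v u → τ v ≤ τ u) ↔ ∀ i : Fin m, C i = false → τ i.succ < τ i.castSucc := by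
  constructor
  · intro h i hi
    refine lt_of_le_of_ne (h _ _ ⟨(Fin.castSucc_lt_succ).le, fun j h1 h2 => ?_⟩) ?_
    · have : j = i := by
        simp only [Fin.le_def, Fin.lt_def, Fin.val_castSucc, Fin.val_succ] at h1 h2
        exact Fin.ext (by omega)
      exact this ▸ hi
    · exact fun e => (Fin.castSucc_lt_succ (i := i)).ne' (τ.injective e)
  · intro h v
    induction v using Fin.induction with
    | zero =>
      intro u hu
      rw [sameBlock_zero.1 hu]
    | succ i ih =>
      intro u hu
      rcases hu.1.eq_or_lt with rfl | hlt
      · exact le_rfl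
      · have hle : u ≤ i.castSucc := by
          simp only [Fin.le_def, Fin.lt_def, Fin.val_castSucc, Fin.val_succ] at hlt ⊢
          omega
        exact (h i (hu.2 i hle Fin.castSucc_lt_succ)).le.trans
          (ih u ⟨hle, fun j h1 h2 => hu.2 j h1 (h2.trans Fin.castSucc_lt_succ)⟩)

/-- The hook of `v`, enlarged by `acc` if `v` lies in the first block. -/
def hookFrom (acc : ℕ) (C : Fin m → Bool) (x : Fin (m + 1) → ℕ) (v : Fin (m + 1)) : ℕ :=
  hook (SameBlock C) x v + if SameBlock C v 0 then acc else 0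

theorem hookFrom_zero (acc : ℕ) (C : Fin m → Bool) (x : Fin (m + 1) → ℕ) :
    hookFrom acc C x 0 = acc + x 0 := by
  have : (Finset.univ.filter fun u => SameBlock C 0 u) = {0} := by
    ext u
    simp [sameBlock_zero]
  rw [hookFrom, hook, this, Finset.sum_singleton, if_pos (SameBlock.refl C 0), add_comm]

theorem hookFrom_succ (acc : ℕ) (c : Bool) (C : Fin m → Bool) (x : Fin (m + 2) → ℕ)
    (v : Fin (m + 1)) :
    hookFrom acc (Fin.cons c C : Fin (m + 1) → Bool) x v.succ =
      hookFrom (if c then 0 else acc + x 0) C (Fin.tail x) v := by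
  simp only [hookFrom, hook, Finset.sum_filter]
  rw [Fin.sum_univ_succ]
  simp only [sameBlock_cons_succ_succ, sameBlock_cons_succ_zero, Fin.tail]
  cases c <;> by_cases h : SameBlock C v 0 <;> simp [h, add_comm, add_assoc]

theorem sum_cons_bool {M : Type*} [AddCommMonoid M] (f : (Fin (m + 1) → Bool) → M) :
    ∑ C, f C =
      ∑ C : Fin m → Bool, f (Fin.cons true C) + ∑ C : Fin m → Bool, f (Fin.cons false C) := by
  rw [← (Fin.consEquiv fun _ => Bool).sum_comp, Fintype.sum_prod_type, Fintype.sum_bool]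
  rfl

variable {K : Type*} [Field K]

/-- The generating function of the cuts of a word as a sum over sets of cuts, with the weight of
the blocks written as a product over the letters. -/
theorem cutGen_ofFn (acc : ℕ) (x : Fin (m + 1) → ℕ) :
    cutGen K acc (List.ofFn x) = ∑ C : Fin m → Bool,
      (∏ i, if C i then PowerSeries.X else 1) *
        PowerSeries.C (∏ v, ((hookFrom acc C x v : ℕ) : K)⁻¹) := by
  induction m generalizing acc with
  | zero => simp [cutGen, hookFrom_zero]
  | succ m ih =>
    have hx : List.ofFn x = x 0 :: x 1 :: List.ofFn (Fin.tail (Fin.tail x)) := by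
      rw [List.ofFn_succ, List.ofFn_succ]
      rfl
    have ht : List.ofFn (Fin.tail x) = x 1 :: List.ofFn (Fin.tail (Fin.tail x)) := by
      rw [List.ofFn_succ]
      rfl
    have key (c : Bool) (C : Fin m → Bool) :
        (∏ i, if (Fin.cons c C : Fin (m + 1) → Bool) i then
          (PowerSeries.X : PowerSeries K) else 1) *
          PowerSeries.C (∏ v, ((hookFrom acc (Fin.cons c C : Fin (m + 1) → Bool) x v : ℕ) : K)⁻¹) =
        PowerSeries.C ((acc + x 0 : ℕ) : K)⁻¹ * ((if c then PowerSeries.X else 1) *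
          ((∏ i, if C i then PowerSeries.X else 1) * PowerSeries.C
            (∏ v, ((hookFrom (if c then 0 else acc + x 0) C (Fin.tail x) v : ℕ) : K)⁻¹))) := by
      rw [Fin.prod_univ_succ (n := m), Fin.prod_univ_succ (n := m + 1)]
      simp only [Fin.cons_zero, Fin.cons_succ, hookFrom_zero, hookFrom_succ, map_mul]
      ring
    rw [hx, cutGen, ← ht, ih, ih, sum_cons_bool]
    simp only [key, ← Finset.mul_sum]
    simp only [if_true, Bool.false_eq_true, if_false, one_mul]
    ring

theorem sum_linearExtensions_sameBlock {M : Type*} [AddCommMonoid M] (C : Fin m → Bool)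
    (f : (Fin (m + 1) → Fin (m + 1)) → M) :
    ∑ q ∈ linearExtensions (SameBlock C) Finset.univ (m + 1), f q =
      ∑ τ : Equiv.Perm (Fin (m + 1)) with ∀ i : Fin m, C i = false → τ i.succ < τ i.castSucc,
        f τ.symm := by
  symm
  refine Finset.sum_bij (fun τ _ => ⇑τ.symm) ?_ ?_ ?_ ?_
  · intro τ hτ
    rw [Finset.mem_filter, ← forall_sameBlock_iff] at hτ
    refine mem_linearExtensions.2 ⟨Finset.image_univ_of_surjective τ.symm.surjective, ?_⟩
    intro i j hij
    simpa using hτ.2 _ _ hij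
  · intro τ _ τ' _ h
    simpa using congrArg Equiv.symm (Equiv.coe_fn_injective h)
  · intro q hq
    have hbij := Finite.injective_iff_bijective.1
      (injective_of_mem_linearExtensions (SameBlock.refl C) hq)
    refine ⟨(Equiv.ofBijective q hbij).symm, ?_, rfl⟩
    rw [Finset.mem_filter, ← forall_sameBlock_iff]
    refine ⟨Finset.mem_univ _, fun v u h => ?_⟩
    obtain ⟨i, rfl⟩ := hbij.surjective v
    obtain ⟨j, rfl⟩ := hbij.surjective u
    have e (k) : (Equiv.ofBijective q hbij).symm (q k) = k :=
      (Equiv.ofBijective q hbij).symm_apply_apply k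
    rw [e, e]
    exact (mem_linearExtensions.1 hq).2 i j h
  · intro τ _
    rfl

/-- The number of ascents of a permutation. -/
def ascentNumber (τ : Equiv.Perm (Fin (m + 1))) : ℕ :=
  (Finset.univ.filter fun i : Fin m => τ i.castSucc < τ i.succ).card

theorem ascentNumber_le (τ : Equiv.Perm (Fin (m + 1))) : ascentNumber τ ≤ m :=
  (Finset.card_le_univ _).trans_eq (Fintype.card_fin m)

/-- Summing the hook formula over all sets of cuts: the permutation `τ` contributes to the sets of
cuts that contain its ascents. -/
theorem wordGen_ofFn [CharZero K] {x : Fin (m + 1) → ℕ} (hx : ∀ i, 0 < x i) :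
    wordGen K (List.ofFn x) = ∑ τ : Equiv.Perm (Fin (m + 1)),
      PowerSeries.C (tailWeight K (m + 1) (fun k => x (τ.symm k))) *
        (PowerSeries.X ^ (ascentNumber τ + 1) * (1 + PowerSeries.X) ^ (m - ascentNumber τ)) := by
  -- The hook formula, for a fixed set of cuts.
  have hhook (C : Fin m → Bool) : ∏ v, ((hookFrom 0 C x v : ℕ) : K)⁻¹ =
      ∑ τ : Equiv.Perm (Fin (m + 1)), tailWeight K (m + 1) (fun k => x (τ.symm k)) *
        ∏ i : Fin m, if C i = false → τ i.succ < τ i.castSucc then 1 else 0 := by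
    have h := sum_tailWeight_linearExtensions (K := K) (r := SameBlock C) (SameBlock.refl C)
      (fun _ _ _ => SameBlock.trans) (fun _ _ => SameBlock.antisymm)
      (fun _ _ _ => SameBlock.total) hx (m + 1) (S := Finset.univ) (by simp) (by simp)
    rw [sum_linearExtensions_sameBlock, Finset.sum_filter] at h
    simp only [hookFrom, ite_self, add_zero]
    rw [← h]
    refine Finset.sum_congr rfl fun τ _ => ?_
    rw [Finset.prod_ite_zero]
    simp
  rw [wordGen_eq_X_mul_cutGen (by simp), cutGen_ofFn]
  simp only [hhook, map_sum, Finset.mul_sum, map_mul]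
  rw [Finset.sum_comm]
  refine Finset.sum_congr rfl fun τ _ => ?_
  have hfac (C : Fin m → Bool) : (∏ i, if C i then (PowerSeries.X : PowerSeries K) else 1) *
      PowerSeries.C (∏ i : Fin m, if C i = false → τ i.succ < τ i.castSucc then (1 : K) else 0) =
      ∏ i, if C i then PowerSeries.X else if τ i.castSucc < τ i.succ then 0 else 1 := by
    rw [map_prod, ← Finset.prod_mul_distrib]
    refine Finset.prod_congr rfl fun i _ => ?_
    rcases lt_or_gt_of_ne (fun e => (Fin.castSucc_lt_succ (i := i)).ne (τ.injective e)) with h | h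
      <;> cases C i <;> simp [h, h.not_gt]
  -- Each position may be cut or not, except that an ascent has to be cut.
  have hsum : ∑ C : Fin m → Bool,
      (∏ i, if C i then (PowerSeries.X : PowerSeries K) else
        if τ i.castSucc < τ i.succ then 0 else 1) =
      PowerSeries.X ^ ascentNumber τ * (1 + PowerSeries.X) ^ (m - ascentNumber τ) := by
    rw [← Fintype.piFinset_univ, ←
      Finset.prod_univ_sum (fun _ : Fin m => (Finset.univ : Finset Bool))
      (fun i c => if c then (PowerSeries.X : PowerSeries K) else
        if τ i.castSucc < τ i.succ then 0 else 1)]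
    have (i : Fin m) : (∑ c : Bool, if c then (PowerSeries.X : PowerSeries K) else
        if τ i.castSucc < τ i.succ then 0 else 1) =
        if τ i.castSucc < τ i.succ then PowerSeries.X else 1 + PowerSeries.X := by
      split_ifs <;> simp [add_comm, *]
    simp only [this]
    rw [Finset.prod_ite, Finset.prod_const, Finset.prod_const, Finset.filter_not,
      Finset.card_sdiff_of_subset (Finset.filter_subset _ _), Finset.card_univ, Fintype.card_fin,
      ascentNumber]
  rw [pow_succ', mul_assoc, ← hsum, Finset.mul_sum, Finset.mul_sum]
  refine Finset.sum_congr rfl fun C _ => ?_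
  rw [← hfac]
  ring

end Cuts

/-! ### The logarithm of the series of iterated integrals -/

section Logarithm

variable {K : Type*} [Field K]

theorem formalIntegral_monomial (k : ℕ) (a : K) :
    formalIntegral (Polynomial.monomial k a) = Polynomial.monomial (k + 1) (a / ((k : K) + 1)) := by
  rw [formalIntegral, Polynomial.sum_monomial_index]
  simp

theorem iteratedIntegral_eq_monomial (n : ℕ) (e : Fin n → ℕ) :
    iteratedIntegral K n e =
      Polynomial.monomial (∑ k, (e k + 1)) (tailWeight K n (fun k => e k + 1)) := by
  induction n with
  | zero => simp [iteratedIntegral, tailWeight]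
  | succ n ih =>
    have hs : ∑ k, (e k + 1) = e 0 + ∑ k, (Fin.tail e k + 1) + 1 := by
      rw [Fin.sum_univ_succ]
      simp only [Fin.tail]
      ring
    rw [iteratedIntegral, ih, Polynomial.X_pow_mul_monomial, add_comm _ (e 0),
      formalIntegral_monomial, tailWeight, hs, div_eq_inv_mul]
    push_cast
    rfl

/-- The linear functional `f ↦ ∑_{k ≤ N} cₖ fₖ` on power series, where `log (1 + X) = ∑ cₖ Xᵏ`. On
polynomials of degree at most `N` without constant term, it is `f ↦ ∫_{-1}^0 f(s) / s ds`. -/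
noncomputable def logFunctional (K : Type*) [Field K] [CharZero K] (N : ℕ) :
    PowerSeries K →ₗ[K] K :=
  ∑ k ∈ Finset.range (N + 1),
    PowerSeries.coeff k (PowerSeries.log K) • PowerSeries.coeff (R := K) k

variable [CharZero K]

theorem logFunctional_apply (N : ℕ) (f : PowerSeries K) :
    logFunctional K N f = ∑ k ∈ Finset.range (N + 1),
      PowerSeries.coeff k (PowerSeries.log K) * PowerSeries.coeff k f := by
  simp only [logFunctional, LinearMap.sum_apply, LinearMap.smul_apply, smul_eq_mul]

theorem logFunctional_X_pow {N a : ℕ} (h : a + 1 ≤ N) :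
    logFunctional K N (PowerSeries.X ^ (a + 1)) = (-1) ^ a / ((a : K) + 1) := by
  rw [logFunctional_apply, Finset.sum_eq_single (a + 1)]
  · simp [pow_succ]
  · intro k _ hk
    simp [PowerSeries.coeff_X_pow, hk]
  · intro hn
    simp at hn
    omega

/-- The Beta integral `B(a, e) = ∫_{-1}^0 s ^ a (1 + s) ^ e ds`, by induction from
`B(a, e + 1) = B(a, e) + B(a + 1, e)`. -/
theorem logFunctional_X_pow_mul {N a e : ℕ} (h : a + e + 1 ≤ N) :
    logFunctional K N (PowerSeries.X ^ (a + 1) * (1 + PowerSeries.X) ^ e) =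
      (-1) ^ a * ((a ! : K) * e !) / ((a + e + 1)! : K) := by
  induction e generalizing a with
  | zero =>
    have : (a ! : K) ≠ 0 := by exact_mod_cast a.factorial_ne_zero
    have h2 : (a : K) + 1 ≠ 0 := by exact_mod_cast a.succ_ne_zero
    rw [pow_zero, mul_one, logFunctional_X_pow h, add_zero, Nat.factorial_succ]
    push_cast
    field_simp
    simp
  | succ e ih =>
    have hsplit : (PowerSeries.X : PowerSeries K) ^ (a + 1) * (1 + PowerSeries.X) ^ (e + 1) =
        PowerSeries.X ^ (a + 1) * (1 + PowerSeries.X) ^ e +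
          PowerSeries.X ^ (a + 1 + 1) * (1 + PowerSeries.X) ^ e := by
      ring
    rw [hsplit, map_add, ih (by omega), ih (by omega)]
    have e1 : a + 1 + e + 1 = (a + e + 1) + 1 := by ring
    have e2 : a + (e + 1) + 1 = (a + e + 1) + 1 := by ring
    have h1 : ((a + e + 1)! : K) ≠ 0 := by exact_mod_cast Nat.factorial_ne_zero _
    have h2 : ((a : K) + e + 1 + 1) ≠ 0 := by exact_mod_cast (a + e + 1).succ_ne_zero
    rw [e1, e2, Nat.factorial_succ (a + e + 1), Nat.factorial_succ a, Nat.factorial_succ e]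
    push_cast
    field_simp
    ring

/-- The coefficient of a permutation with `d` descents in the logarithm. -/
theorem logFunctional_eq_choose {N m d : ℕ} (hd : d ≤ m) (h : m + 1 ≤ N) :
    logFunctional K N (PowerSeries.X ^ (d + 1) * (1 + PowerSeries.X) ^ (m - d)) =
      (-1) ^ d / (((m + 1 : ℕ) : K) * (m.choose d : K)) := by
  rw [logFunctional_X_pow_mul (by omega), Nat.cast_choose K hd, Nat.add_sub_cancel' hd,
    Nat.factorial_succ]
  have h1 : (m ! : K) ≠ 0 := by exact_mod_cast Nat.factorial_ne_zero _
  have h2 : (d ! : K) ≠ 0 := by exact_mod_cast Nat.factorial_ne_zero _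
  have h3 : ((m - d)! : K) ≠ 0 := by exact_mod_cast Nat.factorial_ne_zero _
  have h4 : ((m + 1 : ℕ) : K) ≠ 0 := by exact_mod_cast m.succ_ne_zero
  push_cast at h4 ⊢
  field_simp

/-- In the Strichartz formula, a permutation acts on the letters counted from the last one to the
first; this reversal of positions turns ascents into descents. -/
theorem ascentNumber_mul_revPerm {m : ℕ} (σ : Equiv.Perm (Fin (m + 1))) :
    ascentNumber (σ * Fin.revPerm) = descentNumber σ := by
  refine Finset.card_bij (fun i _ => i.rev.castSucc) ?_ ?_ ?_
  · intro i hi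
    simp only [Finset.mem_filter, Finset.mem_univ, true_and, Equiv.Perm.mul_apply,
      Fin.revPerm_apply, Fin.rev_castSucc, Fin.rev_succ] at hi ⊢
    exact ⟨by simp [i.pos], hi⟩
  · intro i _ j _ h
    simpa using h
  · intro j hj
    simp only [Finset.mem_filter, Finset.mem_univ, true_and] at hj
    obtain ⟨h, hlt⟩ := hj
    refine ⟨Fin.rev ⟨j, by omega⟩, ?_, ?_⟩
    · simp only [Finset.mem_filter, Finset.mem_univ, true_and, Equiv.Perm.mul_apply,
        Fin.revPerm_apply, Fin.rev_castSucc, Fin.rev_succ, Fin.rev_rev]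
      exact hlt
    · simp

/-- The polynomial of iterated integrals attached to a word is the value at this word of the
logarithm, for the convolution, of `prefixWeight`. -/
theorem strichartzIntegral_eq_monomial {m N : ℕ} (hN : m + 1 ≤ N) {x : Fin (m + 1) → ℕ}
    (hx : ∀ i, 0 < x i) :
    strichartzIntegral K (m + 1) x =
      Polynomial.monomial (∑ i, x i) (logFunctional K N (wordGen K (List.ofFn x))) := by
  rw [wordGen_ofFn hx, ← Equiv.sum_comp (Equiv.mulRight (Fin.revPerm (n := m + 1))), map_sum,
    map_sum, strichartzIntegral]
  refine Finset.sum_congr rfl fun σ _ => ?_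
  have hx1 (k : Fin (m + 1)) : x k - 1 + 1 = x k := Nat.sub_add_cancel (hx k)
  have hsum : ∑ k, x (Fin.rev (σ.symm k)) = ∑ i, x i :=
    (σ.symm.trans Fin.revPerm).sum_comp x
  rw [iteratedIntegral_eq_monomial]
  simp only [hx1, hsum, Equiv.coe_mulRight]
  rw [← PowerSeries.smul_eq_C_mul, map_smul,
    logFunctional_eq_choose (ascentNumber_le _) hN, ascentNumber_mul_revPerm,
    Polynomial.C_mul_monomial, smul_eq_mul, mul_comm]
  rfl

variable {B : Type*} [Ring B] [Algebra K B]

theorem coeff_strichartzSeries (L : ℕ → B) (N : ℕ) :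
    PowerSeries.coeff N (strichartzSeries K L) = ∑ k ∈ Finset.range (N + 1),
      PowerSeries.coeff k (PowerSeries.log K) •
        PowerSeries.coeff N ((wordSeries L (prefixWeight K 0) - 1) ^ k) := by
  have hrhs : ∑ k ∈ Finset.range (N + 1), PowerSeries.coeff k (PowerSeries.log K) •
        PowerSeries.coeff N ((wordSeries L (prefixWeight K 0) - 1) ^ k) =
      ∑ x ∈ positiveWords N, logFunctional K N (wordGen K x) • (x.map L).prod := by
    simp only [pow_wordSeries_sub_one, coeff_wordSeries, Finset.smul_sum, logFunctional_apply,
      wordGen, PowerSeries.coeff_mk, Finset.sum_smul, smul_smul]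
    exact Finset.sum_comm
  rw [hrhs, strichartzSeries, PowerSeries.coeff_mk]
  rcases Nat.eq_zero_or_pos N with rfl | hN
  · simp [positiveWords_zero, logFunctional_apply]
  have hterm {m : ℕ} (hm : 1 ≤ m) (hmN : m ≤ N) (c : Composition m) :
      strichartzIntegral K c.length c.blocksFun =
        Polynomial.monomial m (logFunctional K N (wordGen K c.blocks)) := by
    have key : ∀ (n : ℕ) (x : Fin n → ℕ), n ≠ 0 → n ≤ N → (∀ i, 0 < x i) →
        strichartzIntegral K n x =
          Polynomial.monomial (∑ i, x i) (logFunctional K N (wordGen K (List.ofFn x))) := by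
      rintro (_ | n) x h1 h2 h3
      · exact absurd rfl h1
      · exact strichartzIntegral_eq_monomial h2 h3
    rw [key _ _ (c.length_pos_of_pos hm).ne' (c.length_le.trans hmN) c.one_le_blocksFun,
      c.sum_blocksFun, c.ofFn_blocksFun]
  rw [Finset.sum_eq_single_of_mem N (Finset.mem_Icc.2 ⟨hN, le_rfl⟩), sum_positiveWords,
    strichartzTerm, map_sum]
  · refine Finset.sum_congr rfl fun c _ => ?_
    rw [PowerSeries.coeff_mk, hterm hN le_rfl, Polynomial.coeff_monomial_same]
    congr 2
    conv_rhs => rw [← c.ofFn_blocksFun, List.map_ofFn]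
    rfl
  · intro m hm hne
    rw [Finset.mem_Icc] at hm
    rw [strichartzTerm, map_sum]
    refine Finset.sum_eq_zero fun c _ => ?_
    rw [PowerSeries.coeff_mk, hterm hm.1 hm.2, Polynomial.coeff_monomial_of_ne _ hne.symm,
      zero_smul]

/-- The exponential of the Strichartz series is the series of iterated integrals. -/
theorem seriesExp_strichartzSeries (L : ℕ → B) :
    seriesExp K (strichartzSeries K L) = wordSeries L (prefixWeight K 0) := by
  rw [PowerSeries.seriesExp_of_coeff_eq_log (u := wordSeries L (prefixWeight K 0) - 1) ?_
    (coeff_strichartzSeries L)]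
  · abel
  · rw [map_sub, ← PowerSeries.coeff_zero_eq_constantCoeff_apply, coeff_zero_wordSeries]
    simp [prefixWeight]

end Logarithm

/-! ### The Atkinson recursion -/

section Atkinson

variable {K B : Type*} [Field K] [Ring B] [Algebra K B] {θ : K} {T : B →ₗ[K] B}
  {I : Submodule K B} {x : B}

theorem rbLittleWord_mem (hl : ∀ b, ∀ y ∈ I, b * y ∈ I) (hr : ∀ b, ∀ y ∈ I, y * b ∈ I)
    (hx : x ∈ I) (n : ℕ) : rbLittleWord θ T x n ∈ I := by
  rcases n with _ | _ | n
  · exact I.zero_mem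
  · exact hx
  · exact I.sub_mem (I.sub_mem (hl _ _ hx) (hr _ _ hx)) (I.smul_mem _ (hr _ _ hx))

theorem map_rbLittleWord_mul_sub (n : ℕ) :
    T (rbLittleWord θ T x (n + 1)) * x - rbLittleWord θ T x (n + 2) =
      x * T (rbLittleWord θ T x (n + 1)) + θ • (x * rbLittleWord θ T x (n + 1)) := by
  rw [rbLittleWord, rbPreLie]
  abel

/-- Let `T` satisfy the Rota–Baxter identity on a two-sided ideal `I` that contains `x`. If
`t Y' = Y · ∑ 𝔏⁽ʲ⁾(x) tʲ` and `Y(0) = 1`, then `Y` solves the Atkinson recursion. The differential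
equation and the recursion determine each other: by the Rota–Baxter identity, `F · ∑ 𝔏⁽ʲ⁾(x) tʲ⁻¹`
and `F'`, for the solution `F` of the recursion, are the fixed point of `G = T(F x + t G x)`. -/
theorem solvesAtkinson_of_forall_coeff [CharZero K]
    (hl : ∀ b, ∀ y ∈ I, b * y ∈ I) (hr : ∀ b, ∀ y ∈ I, y * b ∈ I) (hx : x ∈ I)
    (hT : ∀ y ∈ I, ∀ z ∈ I, T y * T z = T (T y * z + y * T z + θ • (y * z)))
    {Y : PowerSeries B} (h0 : PowerSeries.coeff 0 Y = 1)
    (hY : ∀ N : ℕ, ((N + 1 : ℕ) : K) • PowerSeries.coeff (N + 1) Y =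
      ∑ j ∈ Finset.range (N + 1), PowerSeries.coeff (N - j) Y * rbWord θ T x (j + 1)) :
    SolvesAtkinson T x Y := by
  have key (N : ℕ) : PowerSeries.coeff (N + 1) Y = T (PowerSeries.coeff N Y * x) := by
    induction N using Nat.strong_induction_on with
    | _ N ih =>
      set y : ℕ → B := fun n => PowerSeries.coeff n Y
      set l : ℕ → B := fun n => rbLittleWord θ T x n
      have hne : ((N + 1 : ℕ) : K) ≠ 0 := by exact_mod_cast N.succ_ne_zero
      apply smul_right_injective B hne
      -- The Rota–Baxter identity, with the recursion for `l (j + 2)`.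
      have hprod : ∀ j ∈ Finset.range N, y (N - j) * T (l (j + 1)) =
          T (y (N - j) * l (j + 1) + y (N - 1 - j) * (T (l (j + 1)) * x - l (j + 2))) := by
        intro j hj
        rw [Finset.mem_range] at hj
        have hNj : N - j = (N - 1 - j) + 1 := by omega
        have hyT : y (N - j) = T (y (N - 1 - j) * x) := by
          rw [hNj]
          exact ih _ (by omega)
        rw [map_rbLittleWord_mul_sub, hyT, hT _ (hl _ _ hx) _ (rbLittleWord_mem hl hr hx _)]
        congr 1
        rw [mul_add, mul_smul_comm, mul_assoc, mul_assoc, add_assoc]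
      have hN : ∑ j ∈ Finset.range N, y (N - 1 - j) * (T (l (j + 1)) * x) =
          (N : K) • (y N * x) := by
        rcases N with _ | N
        · simp
        · rw [← smul_mul_assoc, hY N, Finset.sum_mul]
          exact Finset.sum_congr rfl fun j _ => (mul_assoc _ _ _).symm
      -- Split off the last or the first term of `∑_{j ≤ N} y (N - j) * l (j + 1)`, where `y 0 = 1`.
      have hshift : ∑ j ∈ Finset.range N, y (N - j) * l (j + 1) + l (N + 1) =
          ∑ j ∈ Finset.range N, y (N - 1 - j) * l (j + 2) + y N * x := by
        have h := Finset.sum_range_succ (fun j => y (N - j) * l (j + 1)) N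
        rw [Finset.sum_range_succ'] at h
        simp only [Nat.sub_self, Nat.sub_zero] at h
        rw [show y 0 = 1 from h0, one_mul] at h
        rw [← h]
        congr 1
        exact Finset.sum_congr rfl fun j _ => by rw [Nat.sub_sub, add_comm 1 j]
      calc ((N + 1 : ℕ) : K) • y (N + 1)
          = ∑ j ∈ Finset.range N, y (N - j) * T (l (j + 1)) + T (l (N + 1)) := by
            rw [hY N, Finset.sum_range_succ, Nat.sub_self, h0, one_mul]
            rfl
        _ = T (∑ j ∈ Finset.range N,
              (y (N - j) * l (j + 1) + y (N - 1 - j) * (T (l (j + 1)) * x - l (j + 2))) +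
              l (N + 1)) := by
            rw [Finset.sum_congr rfl hprod, map_add, map_sum]
        _ = T ((N : K) • (y N * x) + y N * x) := by
            congr 1
            simp only [mul_sub, Finset.sum_add_distrib, Finset.sum_sub_distrib]
            rw [hN, add_right_comm, hshift]
            abel
        _ = ((N + 1 : ℕ) : K) • T (y N * x) := by
            rw [← map_smul]
            congr 1
            push_cast
            rw [add_smul, one_smul]
  rw [SolvesAtkinson]
  ext N
  rw [coeffwise, map_add, PowerSeries.coeff_mk, ← mul_assoc]
  rcases N with _ | N
  · simp [h0]
  · rw [PowerSeries.coeff_succ_mul_X, PowerSeries.coeff_mul_C, key, PowerSeries.coeff_one,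
      if_neg N.succ_ne_zero, zero_add]

/-- The Atkinson recursion for an operator that is Rota–Baxter on a two-sided ideal containing
`x`. -/
theorem solvesAtkinson_seriesExp [CharZero K]
    (hl : ∀ b, ∀ y ∈ I, b * y ∈ I) (hr : ∀ b, ∀ y ∈ I, y * b ∈ I) (hx : x ∈ I)
    (hT : ∀ y ∈ I, ∀ z ∈ I, T y * T z = T (T y * z + y * T z + θ • (y * z))) :
    SolvesAtkinson T x (seriesExp K (strichartzSeries K (fun i => rbWord θ T x i))) := by
  rw [seriesExp_strichartzSeries]
  refine solvesAtkinson_of_forall_coeff hl hr hx hT ?_ (coeff_wordSeries_prefixWeight _)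
  simp [coeff_zero_wordSeries, prefixWeight]

end Atkinson

section Unitization

variable {K A : Type*} [Field K] [NonUnitalRing A] [Module K A]

theorem mul_mem_range_inrHom (b : Unitization K A) (y : Unitization K A)
    (hy : y ∈ LinearMap.range (Unitization.inrHom K K A)) :
    b * y ∈ LinearMap.range (Unitization.inrHom K K A) ∧
      y * b ∈ LinearMap.range (Unitization.inrHom K K A) := by
  obtain ⟨a, rfl⟩ := hy
  constructor
  · exact ⟨(b * Unitization.inr a).snd, by ext <;> simp⟩
  · exact ⟨(Unitization.inr a * b).snd, by ext <;> simp⟩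

variable [IsScalarTower K A A] [SMulCommClass K A A] {θ : K} {R : A →ₗ[K] A}

theorem unitizationOp_inr (a : A) :
    unitizationOp R (Unitization.inr a) = Unitization.inr (R a) :=
  rfl

theorem rbLittleWord_unitizationOp (X : A) (n : ℕ) :
    rbLittleWord θ (unitizationOp R) (Unitization.inr X) n =
      Unitization.inr (rbLittleWord θ R X n) := by
  induction n with
  | zero => rfl
  | succ n ih =>
    rcases n with _ | n
    · rfl
    · rw [rbLittleWord, rbLittleWord, ih]
      simp only [rbPreLie, unitizationOp_inr, Unitization.inr_sub, Unitization.inr_mul,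
        Unitization.inr_smul]

end Unitization

theorem mainTheorem8 {K : Type*} [Field K] [CharZero K] (θ : K) :
    -- unital Rota–Baxter algebras
    (∀ (A : Type*) [Ring A] [Algebra K A] (R : A →ₗ[K] A), IsRotaBaxter θ R → ∀ X : A,
      SolvesAtkinson R X (seriesExp K (strichartzSeries K (fun i => rbWord θ R X i)))) ∧
    -- Rota–Baxter algebras without unit; the series have coefficients in the unitization
    (∀ (A : Type*) [NonUnitalRing A] [Module K A] [IsScalarTower K A A] [SMulCommClass K A A]
      (R : A →ₗ[K] A), IsRotaBaxter θ R → ∀ X : A,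
      SolvesAtkinson (unitizationOp R) (Unitization.inr X)
        (seriesExp K (strichartzSeries K (fun i => Unitization.inr (rbWord θ R X i))))) := by
  refine ⟨fun A _ _ R hR X => ?_, fun A _ _ _ _ R hR X => ?_⟩
  · exact solvesAtkinson_seriesExp (I := ⊤) (fun _ _ _ => trivial) (fun _ _ _ => trivial) trivial
      fun y _ z _ => hR y z
  · have hL : (fun i => (Unitization.inr (rbWord θ R X i) : Unitization K A)) =
        fun i => rbWord θ (unitizationOp R) (Unitization.inr X) i := by
      funext i
      rw [rbWord, rbWord, rbLittleWord_unitizationOp, unitizationOp_inr]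
    rw [hL]
    refine solvesAtkinson_seriesExp (I := LinearMap.range (Unitization.inrHom K K A))
      (fun b y hy => (mul_mem_range_inrHom b y hy).1)
      (fun b y hy => (mul_mem_range_inrHom b y hy).2) ⟨X, rfl⟩ ?_
    rintro _ ⟨a, rfl⟩ _ ⟨b, rfl⟩
    simp only [Unitization.inrHom_apply, unitizationOp_inr, ← Unitization.inr_mul,
      ← Unitization.inr_add, ← Unitization.inr_smul]
    rw [hR a b]
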